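/- Let $\mathcal F\subseteq\mathbb R^{n\times p}$ be a linear subspace, with the inner product $\langle X,Y\rangle=\operatorname{tr}(X^\top Y)$ and the Frobenius norm, and let $\mathcal G=\operatorname{span}\{X_1^\top X_2: X_1,X_2\in\mathcal F\}$. Assume that $XT\in\mathcal F$ for all $X\in\mathcal F$, $T\in\mathcal G$; that $\phi:\mathcal F\to\mathcal F$ is a one-to-one self-adjoint linear map; and that $\psi:\mathcal G\to\mathcal G$ is a linear map with $\phi(XT)=\phi(X)\psi(T)$ and $\psi(\phi(X)^\top X)=X^\top\phi(X)$ for all $X\in\mathcal F$, $T\in\mathcal G$. Put $$C(X)=X^\top\phi(X)-I_p,\quad \mathcal A(X)=\tfrac32X-\tfrac12X\phi(X)^\top X,\quad \mathcal M=\{X\in\mathcal F: C(X)=0\},\quad \mathcal S_1=\{T^\top+\psi(T):T\in\mathcal G\}.$$ Let $f:\mathcal F\to\mathbb R$ be twice differentiable (i.e. $f$ and $\nabla f$ are differentiable on $\mathcal F$), and for $\beta\in\mathbb R$ let $$h(X)=f(\mathcal A(X))+\tfrac\beta2\|X^\top\phi(X)-I_p\|^2,\qquad X\in\mathcal F.$$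 A point $Y\in\mathcal F$ is a second-order stationary point of GOCDF (minimize $h$ over $\mathcal F$) if $\nabla h(Y)=0$ and $\langle T,\nabla^2h(Y)[T]\rangle\ge0$ for all $T\in\mathcal F$. It is a second-order stationary point of GOOCP (minimize $f$ over $\mathcal M$) if $Y\in\mathcal M$, $\operatorname{grad}f(Y)=0$ and $\langle Z,\operatorname{hess}f(Y)[Z]\rangle\ge0$ for all $Z\in T_Y\mathcal M$, where $\operatorname{grad}$ and $\operatorname{hess}$ are the Riemannian gradient and Hessian on the embedded submanifold $\mathcal M\subseteq\mathcal F$ with the inherited metric. Fix $X\in\mathcal M$. For $Y\in\mathcal F$ let $\sigma(Y)$ be the smallest singular value of $DC(Y):\mathcal F\to\mathcal S_1$, i.e. the $(\dim\mathcal S_1)$-th one in decreasing order. Let $\delta=\sigma(X)$; let $\rho$ be the largest $\rho\in(0,1]$ such that $\sigma(Y)\ge\frac12\delta$ for all $Y\in\mathcal F$ with $\|Y-X\|\le\rho$; and let $\Delta_X=\{Y\in\mathcal F:\|Y-X\|\le\rho\}$, $M=\sup_{Y\in\Delta_X}\|\nabla f(\mathcal A(Y))\|$, and $L$ the Lipschitz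 constant of $\phi$. Let $a$ be any constant with $\|Y\|\le a/3$ for $Y\in\Delta_X$ such that $$\|D\mathcal A(Y_1)[Z]-D\mathcal A(Y_2)[Z]\|\le aL\|Z\|\|Y_1-Y_2\|,\qquad \|D\mathcal A(Y_1)^*[Z]-D\mathcal A(Y_2)^*[Z]\|\le aL\|Z\|\|Y_1-Y_2\|$$ for all $Y_1,Y_2\in\Delta_X$, $Z\in\mathcal F$, and let $c$ be any constant with $\|D(C\circ\mathcal A)(Y_1)[Z]-D(C\circ\mathcal A)(Y_2)[Z]\|\le 2cL\|Z\|\|Y_1-Y_2\|$ for all such $Y_1,Y_2,Z$. Set $$\varepsilon_X=\min\Big\{\frac{\rho}{2},\ \frac{\delta}{4L},\ \frac{\delta}{2a^2L^2+6L},\ \frac{3\delta^2}{32acL^2}\Big\},\qquad \Omega_X=\{Y\in\mathcal F:\|Y-X\|\le\varepsilon_X\},$$ $$\tilde\beta_X=\max\Big\{\frac{2a^3L^2M+30aLM}{3\delta^2},\ \frac{16acLM}{3\delta^2},\ \frac{18aLM+3a^2L^2M+2a^3L^2M+1}{9\delta^2-9\delta^2c}\Big\},$$ where the last entry of the maximum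 is read as $0$ if $c=1$. Theorem. If $\beta>\tilde\beta_X$, then a point $Y\in\Omega_X$ is a second-order stationary point of GOCDF if and only if it is a second-order stationary point of GOOCP. -/

import Mathlib

open scoped InnerProductSpace Topology ContDiff Gradient

noncomputable section

namespace GOOCP

/-! ### Real matrices with the Frobenius inner product -/

/-- Real `n × p` matrices with the inner product `⟨X, Y⟩ = ∑ i j, X i j * Y i j = tr (Xᵀ Y)` and the
Frobenius norm. -/
abbrev Mat (n p : ℕ) := EuclideanSpace ℝ (Fin n × Fin p)

/-- The underlying matrix (an array of entries). -/
def toMatrix {n p : ℕ} (X : Mat n p) : Matrix (Fin n) (Fin p) ℝ :=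
  Matrix.of fun i j => X (i, j)

/-- The element of `Mat n p` with the given entries. -/
def ofMatrix {n p : ℕ} (A : Matrix (Fin n) (Fin p) ℝ) : Mat n p :=
  WithLp.toLp 2 fun ij => A ij.1 ij.2

/-- Matrix multiplication. -/
def mmul {n p q : ℕ} (X : Mat n p) (Y : Mat p q) : Mat n q :=
  ofMatrix (toMatrix X * toMatrix Y)

/-- The identity matrix. -/
def mone (p : ℕ) : Mat p p := ofMatrix 1

/-- Transposition, as a linear map. -/
def mtr {n p : ℕ} : Mat n p →ₗ[ℝ] Mat p n where
  toFun X := ofMatrix (toMatrix X).transpose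
  map_add' X Y := by ext; simp [ofMatrix, toMatrix]
  map_smul' c X := by ext; simp [ofMatrix, toMatrix]

local infixl:70 " ⬝ " => mmul

/-- The inner product of `Mat n p` is the Frobenius one. -/
theorem inner_eq_trace {n p : ℕ} (X Y : Mat n p) :
    ⟪X, Y⟫_ℝ = ((toMatrix X).transpose * toMatrix Y).trace := by
  simp only [PiLp.inner_apply, Matrix.trace, Matrix.diag, Matrix.mul_apply, toMatrix,
    Matrix.transpose_apply, Matrix.of_apply, Fintype.sum_prod_type]
  rw [Finset.sum_comm]
  simp [mul_comm]

/-! ### The feasible set -/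

/-- The space `𝒢 = span {X₁ᵀ X₂ : X₁, X₂ ∈ ℱ}`. -/
def gram {n p : ℕ} (F : Submodule ℝ (Mat n p)) : Submodule ℝ (Mat p p) :=
  Submodule.span ℝ {T | ∃ X₁ ∈ F, ∃ X₂ ∈ F, T = mtr X₁ ⬝ X₂}

theorem mtr_mmul_mem_gram {n p : ℕ} {F : Submodule ℝ (Mat n p)} (X₁ X₂ : F) :
    mtr (X₁ : Mat n p) ⬝ (X₂ : Mat n p) ∈ gram F :=
  Submodule.subset_span ⟨X₁, X₁.2, X₂, X₂.2, rfl⟩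

/-- The data of the generalized orthogonality constraint `Xᵀ φ(X) = I`, `X ∈ ℱ`, with the standing
assumptions: `ℱ𝒢 ⊆ ℱ`, the linear map `φ : ℱ → ℱ` is one-to-one and self-adjoint, and `ψ : 𝒢 → 𝒢`
is linear with `φ(XT) = φ(X) ψ(T)` and `ψ(φ(X)ᵀ X) = Xᵀ φ(X)`. -/
structure Constraint (n p : ℕ) where
  F : Submodule ℝ (Mat n p)
  mmul_mem : ∀ X ∈ F, ∀ T ∈ gram F, X ⬝ T ∈ F
  φ : F →ₗ[ℝ] F
  φ_injective : Function.Injective φ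
  φ_selfAdjoint : ∀ X Y : F, ⟪φ X, Y⟫_ℝ = ⟪X, φ Y⟫_ℝ
  ψ : gram F →ₗ[ℝ] gram F
  φ_mmul : ∀ (X : F) (T : gram F),
    (φ ⟨(X : Mat n p) ⬝ (T : Mat p p), mmul_mem X X.2 T T.2⟩ : Mat n p)
      = (φ X : Mat n p) ⬝ (ψ T : Mat p p)
  ψ_gram : ∀ X : F,
    (ψ ⟨mtr (φ X : Mat n p) ⬝ (X : Mat n p), mtr_mmul_mem_gram (φ X) X⟩ : Mat p p)
      = mtr (X : Mat n p) ⬝ (φ X : Mat n p)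

namespace Constraint

variable {n p : ℕ} (P : Constraint n p)

/-- The constraint mapping `C(X) = Xᵀ φ(X) - I`. -/
def C (X : P.F) : Mat p p := mtr (X : Mat n p) ⬝ (P.φ X : Mat n p) - mone p

/-- The feasible set `ℳ = {X ∈ ℱ : Xᵀ φ(X) = I}`. -/
def M : Set P.F := {X | mtr (X : Mat n p) ⬝ (P.φ X : Mat n p) = mone p}

/-- The constraint dissolving mapping `𝒜(X) = (3/2) X - (1/2) X φ(X)ᵀ X`. -/
def A (X : P.F) : P.F :=
  (3 / 2 : ℝ) • X - (1 / 2 : ℝ) •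
    ⟨(X : Mat n p) ⬝ (mtr (P.φ X : Mat n p) ⬝ (X : Mat n p)),
      P.mmul_mem X X.2 _ (mtr_mmul_mem_gram (P.φ X) X)⟩

/-- The generalized symmetrization `Φ(T) = Tᵀ + ψ(T)` on `𝒢`. -/
def Phi : gram P.F →ₗ[ℝ] Mat p p :=
  mtr ∘ₗ (gram P.F).subtype + (gram P.F).subtype ∘ₗ P.ψ

/-- `𝒮₁ = {Φ(T) : T ∈ 𝒢}`. The values of every differential `DC(X) : ℱ → 𝒮₁` lie in it. -/
def S₁ : Submodule ℝ (Mat p p) := LinearMap.range P.Phi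

/-! ### Riemannian notions on the feasible set -/

/-- The tangent space of `ℳ` at `X`: the velocities at `X` of smooth curves in `ℳ` through `X`. -/
def tangentSpace (X : P.F) : Submodule ℝ P.F :=
  Submodule.span ℝ {Z | ∃ γ : ℝ → P.F, ContDiffAt ℝ ∞ γ 0 ∧ (∀ᶠ t in 𝓝 0, γ t ∈ P.M) ∧
    γ 0 = X ∧ HasDerivAt γ Z 0}

/-- The Riemannian gradient on `ℳ` for the metric inherited from the Frobenius inner product:
the orthogonal projection of the Euclidean gradient to the tangent space. -/
def rgrad (f : P.F → ℝ) (X : P.F) : P.F :=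
  (P.tangentSpace X).starProjection (∇ f X)

/-- The Riemannian Hessian on `ℳ`: the Levi-Civita derivative of the Riemannian gradient, that is,
the tangential part of the derivative of `grad f` along `ℳ` in the direction `Z ∈ T_X ℳ`. -/
def rhess (f : P.F → ℝ) (X Z : P.F) : P.F :=
  (P.tangentSpace X).starProjection (fderivWithin ℝ (P.rgrad f) P.M X Z)

/-- Second-order stationary points of `min f(X)` subject to `X ∈ ℳ`. -/
def IsSecondOrderStationary (f : P.F → ℝ) (X : P.F) : Prop :=
  X ∈ P.M ∧ P.rgrad f X = 0 ∧ ∀ Z ∈ P.tangentSpace X, 0 ≤ ⟪Z, P.rhess f X Z⟫_ℝ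

/-! ### The constraint dissolving function -/

/-- `h(X) = f(𝒜(X)) + (β/2) ‖Xᵀ φ(X) - I‖²`. -/
def cdf (f : P.F → ℝ) (β : ℝ) (X : P.F) : ℝ :=
  f (P.A X) + β / 2 * ‖P.C X‖ ^ 2

/-- Second-order stationary points of the unconstrained problem of minimizing `h` over `ℱ`. -/
def IsSecondOrderStationaryCDF (f : P.F → ℝ) (β : ℝ) (X : P.F) : Prop :=
  ∇ (P.cdf f β) X = 0 ∧
    ∀ T : P.F, 0 ≤ ⟪T, fderiv ℝ (∇ (P.cdf f β)) X T⟫_ℝ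

/-! ### Constants -/

/-- The smallest singular value of `DC(X)` as a linear map from `ℱ` to `𝒮₁`, that is, the
`dim 𝒮₁`-th one in decreasing order (the sequence starts at index `0`, and enlarging the codomain
from `𝒮₁` to all `p × p` matrices only appends zeros to it). -/
def sigmaMin (X : P.F) : ℝ :=
  (fderiv ℝ P.C X).toLinearMap.singularValues (Module.finrank ℝ P.S₁ - 1)

/-- `ρ_X`: the largest radius `ρ ≤ 1` such that the smallest singular value of `DC(Y)` is at least
half of that of `DC(X)` for all `Y` with `‖Y - X‖ ≤ ρ`. -/
def rho (X : P.F) : ℝ :=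
  sSup {ρ | 0 < ρ ∧ ρ ≤ 1 ∧ ∀ Y : P.F, ‖Y - X‖ ≤ ρ → P.sigmaMin X / 2 ≤ P.sigmaMin Y}

/-- `Δ_X = {Y ∈ ℱ : ‖Y - X‖ ≤ ρ_X}`. -/
def Delta (X : P.F) : Set P.F := {Y | ‖Y - X‖ ≤ P.rho X}

/-- `M_{X,f}`, the supremum of `‖∇f(𝒜(Y))‖` over `Y ∈ Δ_X`. -/
def Mf (f : P.F → ℝ) (X : P.F) : ℝ := sSup {r | ∃ Y ∈ P.Delta X, r = ‖∇ f (P.A Y)‖}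

/-- The Lipschitz constant `L_φ` of `φ`. -/
def Lphi : ℝ := sSup {r | ∃ Y₁ Y₂ : P.F, Y₁ ≠ Y₂ ∧ r = ‖P.φ Y₁ - P.φ Y₂‖ / ‖Y₁ - Y₂‖}

/-- `a` is an admissible constant `α_𝒜` for `X`: `D𝒜` and `D𝒜*` are `a L_φ`-Lipschitz on `Δ_X`,
and `‖Y‖ ≤ a / 3` for `Y ∈ Δ_X`. -/
structure IsAlphaA (X : P.F) (a : ℝ) : Prop where
  lipschitz : ∀ Y₁ ∈ P.Delta X, ∀ Y₂ ∈ P.Delta X, ∀ Z : P.F,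
    ‖fderiv ℝ P.A Y₁ Z - fderiv ℝ P.A Y₂ Z‖ ≤ a * P.Lphi * ‖Z‖ * ‖Y₁ - Y₂‖
  lipschitz_adjoint : ∀ Y₁ ∈ P.Delta X, ∀ Y₂ ∈ P.Delta X, ∀ T : P.F,
    ‖(fderiv ℝ P.A Y₁).adjoint T - (fderiv ℝ P.A Y₂).adjoint T‖
      ≤ a * P.Lphi * ‖T‖ * ‖Y₁ - Y₂‖
  norm_le : ∀ Y ∈ P.Delta X, ‖Y‖ ≤ a / 3

/-- `c` is an admissible constant `α_{C,𝒜}` for `X`: `D(C ∘ 𝒜)` is `2 c L_φ`-Lipschitz on `Δ_X`. -/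
def IsAlphaCA (X : P.F) (c : ℝ) : Prop :=
  ∀ Y₁ ∈ P.Delta X, ∀ Y₂ ∈ P.Delta X, ∀ Z : P.F,
    ‖fderiv ℝ (P.C ∘ P.A) Y₁ Z - fderiv ℝ (P.C ∘ P.A) Y₂ Z‖
      ≤ 2 * c * P.Lphi * ‖Z‖ * ‖Y₁ - Y₂‖

/-- The radius `ε_X` for `α_𝒜 = a` and `α_{C,𝒜} = c`. -/
def eps (X : P.F) (a c : ℝ) : ℝ :=
  min (P.rho X / 2) <| min (P.sigmaMin X / (4 * P.Lphi)) <|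
    min (P.sigmaMin X / (2 * a ^ 2 * P.Lphi ^ 2 + 6 * P.Lphi))
      (3 * P.sigmaMin X ^ 2 / (32 * a * c * P.Lphi ^ 2))

/-- `Ω_X = {Y ∈ ℱ : ‖Y - X‖ ≤ ε_X}`. -/
def Omega (X : P.F) (a c : ℝ) : Set P.F := {Y | ‖Y - X‖ ≤ P.eps X a c}

/-- The threshold `β̃_X` for `α_𝒜 = a` and `α_{C,𝒜} = c`. For `c = 1` the last entry of the maximum
has denominator `0`, so its Lean value is `0` and it plays no role. -/
def betaThreshold (f : P.F → ℝ) (X : P.F) (a c : ℝ) : ℝ :=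
  max ((2 * a ^ 3 * P.Lphi ^ 2 * P.Mf f X + 30 * a * P.Lphi * P.Mf f X)
      / (3 * P.sigmaMin X ^ 2)) <|
    max (16 * a * c * P.Lphi * P.Mf f X / (3 * P.sigmaMin X ^ 2))
      ((18 * a * P.Lphi * P.Mf f X + 3 * a ^ 2 * P.Lphi ^ 2 * P.Mf f X
          + 2 * a ^ 3 * P.Lphi ^ 2 * P.Mf f X + 1)
        / (9 * P.sigmaMin X ^ 2 - 9 * P.sigmaMin X ^ 2 * c))

end Constraint

end GOOCP

end

/-!
Write `S_Y(Z) = φ(Y)ᵀ Z + φ(Z)ᵀ Y`, the transpose of `DC(Y)[Z]`. Every `T` of this form satisfies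
`ψ(T) = Tᵀ` (`Constraint.ψ_sym`), hence `S_Y(Y T) = 2 T` at a feasible point `Y`
(`Constraint.sym_act_of_mem`). Therefore `D𝒜(Y)[Z] = Z - Y S_Y(Z) / 2` is a linear projection onto
`ker DC(Y)`, and this kernel is the tangent space: the same identity gives a chart whose derivative
at `Y` is the identity and which `DC(Y)` carries to `C` (`Constraint.mem_tangentSpace_iff`).

*Feasible points.* There `∇h(Y) = D𝒜(Y)* ∇f(Y)` vanishes exactly when `∇f(Y)` is normal to `ℳ`.
On `ℳ` the Riemannian gradient is `P k` with `P` the orthogonal projection onto the tangent space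
and `k = ∇(f ∘ 𝒜)`. At a zero of `k` its derivative is `P Dk`, so the Riemannian Hessian has
the quadratic form of `∇²(f ∘ 𝒜)` on tangent vectors (`Constraint.inner_rhess`), and the penalty
adds `β ‖DC(Y)[Z]‖²`, which is zero on them. For a general `Z`, with `S = S_Y(Z)`, the quadratic
form of `∇²(f ∘ 𝒜)` at `Z` is the one at the tangent vector `D𝒜(Y)[Z]` minus
`(3 / 4) ⟪∇f(Y), Y S²⟫` (`Constraint.inner_d2A_sub`), so the penalty dominates the defect as soon as
`β ≥ (3 / 4) ‖∇f(Y)‖ ‖Y‖` (`Constraint.isSecondOrderStationary_iff_of_mem`).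

*Infeasible points.* Since `DC(Y)[Y Cᵀ] = 2 C + 2 C²` and `D𝒜(Y)[Y Cᵀ] = -(3 / 2) Y (C²)ᵀ` for
`C = C(Y)`, a zero of `∇h` with `‖C‖ ≤ 1 / 2` is feasible if `β > (3 / 2) ‖∇f(𝒜(Y))‖ ‖Y‖`
(`Constraint.mem_M_of_gradient_cdf_eq_zero`).

*Constants.* Surjectivity of `DC(X)` onto `𝒮₁` and a norm estimate give `0 < σ(X) ≤ 2 a L / 3`.
Hence the first entry of the threshold for `β` is at least `a M / 2 ≥ (3 / 2) ‖∇f(𝒜(Y))‖ ‖Y‖`, and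
the third entry of the radius keeps `‖C(Y)‖` at most `1 / 2`.
-/

open scoped InnerProductSpace Topology ContDiff Gradient

noncomputable section

namespace GOOCP

/-! ### Matrix algebra in the Frobenius space -/

section MatrixAlgebra

variable {n p q r : ℕ}

theorem toMatrix_injective : Function.Injective (toMatrix : Mat n p → Matrix (Fin n) (Fin p) ℝ) := by
  intro X Y h
  ext ⟨i, j⟩
  exact congrFun (congrFun h i) j

@[simp] theorem toMatrix_mmul (X : Mat n p) (Y : Mat p q) :
    toMatrix (mmul X Y) = toMatrix X * toMatrix Y := rfl

@[simp] theorem toMatrix_mtr (X : Mat n p) : toMatrix (mtr X) = (toMatrix X).transpose := rfl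

@[simp] theorem toMatrix_mone : toMatrix (mone p) = 1 := rfl

@[simp] theorem toMatrix_add (X Y : Mat n p) : toMatrix (X + Y) = toMatrix X + toMatrix Y := rfl

@[simp] theorem toMatrix_sub (X Y : Mat n p) : toMatrix (X - Y) = toMatrix X - toMatrix Y := rfl

@[simp] theorem toMatrix_neg (X : Mat n p) : toMatrix (-X) = -toMatrix X := rfl

@[simp] theorem toMatrix_smul (c : ℝ) (X : Mat n p) : toMatrix (c • X) = c • toMatrix X := rfl

@[simp] theorem toMatrix_zero : toMatrix (0 : Mat n p) = 0 := rfl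

theorem inner_mtr_mtr (X Y : Mat n p) : ⟪mtr X, mtr Y⟫_ℝ = ⟪X, Y⟫_ℝ := by
  simp only [PiLp.inner_apply, Fintype.sum_prod_type]
  exact Finset.sum_comm

theorem norm_mtr (X : Mat n p) : ‖mtr X‖ = ‖X‖ := by
  rw [@norm_eq_sqrt_real_inner _ _ _ (mtr X), inner_mtr_mtr, ← norm_eq_sqrt_real_inner]

/-- The Frobenius norm is submultiplicative: Cauchy–Schwarz in each entry of the product. -/
theorem norm_mmul_le (X : Mat n p) (Y : Mat p q) : ‖mmul X Y‖ ≤ ‖X‖ * ‖Y‖ := by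
  refine le_of_sq_le_sq ?_ (by positivity)
  rw [mul_pow, EuclideanSpace.real_norm_sq_eq, EuclideanSpace.real_norm_sq_eq,
    EuclideanSpace.real_norm_sq_eq, Fintype.sum_prod_type, Fintype.sum_prod_type,
    Fintype.sum_prod_type_right, Finset.sum_mul_sum]
  refine Finset.sum_le_sum fun i _ => Finset.sum_le_sum fun k _ => ?_
  exact Finset.sum_mul_sq_le_sq_mul_sq Finset.univ (fun j => X (i, j)) fun j => Y (j, k)

end MatrixAlgebra

/-! ### Calculus of bilinear maps -/

section Bilinear

variable {E F G : Type*} [NormedAddCommGroup E] [NormedSpace ℝ E] [NormedAddCommGroup F]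
  [NormedSpace ℝ F] [NormedAddCommGroup G] [NormedSpace ℝ G]

theorem hasFDerivAt_bilinear_id (B : E →L[ℝ] F →L[ℝ] G) {k : E → F} {k' : E →L[ℝ] F} {x : E}
    (hk : HasFDerivAt k k' x) :
    HasFDerivAt (fun x => B x (k x)) (B.flip (k x) + (B x).comp k') x := by
  refine (B.hasFDerivAt_of_bilinear (hasFDerivAt_id x) hk).congr_fderiv ?_
  ext v
  simp [add_comm]

theorem hasFDerivAt_bilinear_diag (B : E →L[ℝ] E →L[ℝ] G) (x : E) :
    HasFDerivAt (fun x => B x x) (B x + B.flip x) x := by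
  refine (hasFDerivAt_bilinear_id B (hasFDerivAt_id x)).congr_fderiv ?_
  ext v
  simp [add_comm]

theorem contDiff_bilinear_diag (B : E →L[ℝ] E →L[ℝ] G) : ContDiff ℝ ∞ fun x => B x x :=
  B.contDiff.clm_apply contDiff_id

theorem hasFDerivAt_clm_comp (L : F →L[ℝ] G) {k : E → F} {k' : E →L[ℝ] F} {x : E}
    (hk : HasFDerivAt k k' x) : HasFDerivAt (fun x => L (k x)) (L.comp k') x :=
  L.hasFDerivAt.comp x hk

theorem differentiable_clm_comp_right (L : F →L[ℝ] G) (B : E →L[ℝ] E →L[ℝ] F) :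
    Differentiable ℝ fun x => L.comp (B x) :=
  (differentiable_const L).clm_comp B.differentiable

/-- Differentiability of the differential of a map of the form `(3/2) x - (1/2) B x (k x)`, where
`S` is the differential of `k`. -/
theorem differentiableAt_cubic_fderiv (B : E →L[ℝ] F →L[ℝ] E) (S : E →L[ℝ] E →L[ℝ] F)
    {k : E → F} {x : E} (hk : DifferentiableAt ℝ k x) :
    DifferentiableAt ℝ (fun x => (3 / 2 : ℝ) • ContinuousLinearMap.id ℝ E
      - (1 / 2 : ℝ) • (B.flip (k x) + (B x).comp (S x))) x :=
  (differentiableAt_const _).sub (((B.flip.differentiableAt.comp x hk).add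
    (B.differentiableAt.clm_comp S.differentiableAt)).const_smul (1 / 2 : ℝ))

/-- The second differential, on the diagonal, of the map `(3/2) x - (1/2) B x (k x)`. -/
theorem fderiv_cubic_fderiv_apply (B : E →L[ℝ] F →L[ℝ] E) (S : E →L[ℝ] E →L[ℝ] F)
    {k : E → F} {x : E} (hk : HasFDerivAt k (S x) x) (z : E) :
    fderiv ℝ (fun x => (3 / 2 : ℝ) • ContinuousLinearMap.id ℝ E
      - (1 / 2 : ℝ) • (B.flip (k x) + (B x).comp (S x))) x z z
      = - B z (S x z) - (1 / 2 : ℝ) • B x (S z z) := by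
  have h1 := B.flip.hasFDerivAt.comp x hk
  have h2 := (B.hasFDerivAt (x := x)).clm_comp (S.hasFDerivAt (x := x))
  have h := (hasFDerivAt_const ((3 / 2 : ℝ) • ContinuousLinearMap.id ℝ E) x).sub
    ((h1.add h2).const_smul (1 / 2 : ℝ))
  refine (congrArg (fun L => L z z) h.fderiv).trans ?_
  simp
  module

/-- The product rule for `P k` at a zero of `k` needs only the continuity of `P`. -/
theorem hasFDerivWithinAt_clm_apply_of_eq_zero {M : Set E} {P : E → E →L[ℝ] E} {k : E → E}
    {k' : E →L[ℝ] E} {Y : E} (hP : ContinuousWithinAt P M Y) (hk : HasFDerivWithinAt k k' M Y)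
    (h0 : k Y = 0) : HasFDerivWithinAt (fun x => P x (k x)) ((P Y).comp k') M Y := by
  rw [hasFDerivWithinAt_iff_isLittleO] at hk ⊢
  have hb : P =O[𝓝[M] Y] (fun _ => (1 : ℝ)) := hP.isBigO_one ℝ
  have hs : (fun x => P x - P Y) =o[𝓝[M] Y] (fun _ => (1 : ℝ)) := by
    rw [Asymptotics.isLittleO_one_iff]
    simpa using Filter.Tendsto.sub hP (tendsto_const_nhds (x := P Y))
  have e1 : (fun x => P x (k x - k Y - k' (x - Y))) =o[𝓝[M] Y] fun x => x - Y := by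
    refine (Asymptotics.IsBigO.of_norm_le fun x => (P x).le_opNorm _).trans_isLittleO ?_
    have := hb.norm_left.mul_isLittleO hk.norm_left.norm_right
    simpa using this
  have e2 : (fun x => (P x - P Y) (k' (x - Y))) =o[𝓝[M] Y] fun x => x - Y := by
    refine (Asymptotics.IsBigO.of_norm_le fun x => (P x - P Y).le_opNorm _).trans_isLittleO ?_
    have := hs.norm_left.mul_isBigO (k'.isBigO_sub (𝓝[M] Y) Y).norm_left.norm_right
    simpa using this
  refine (e1.add e2).congr_left fun x => ?_
  simp [h0]

/-- A derivative within `M` is determined on velocities of curves in `M`. -/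
theorem fderivWithin_apply_of_curve {M : Set E} {r : E → E} {r' : E →L[ℝ] E}
    {Y Z : E} (hr : HasFDerivWithinAt r r' M Y) {γ : ℝ → E} (hM : ∀ᶠ t in 𝓝 0, γ t ∈ M)
    (h0 : γ 0 = Y) (hγ : HasDerivAt γ Z 0) : fderivWithin ℝ r M Y Z = r' Z := by
  subst h0
  have aux : ∀ L : E →L[ℝ] E, HasFDerivWithinAt r L M (γ 0) → HasDerivAt (r ∘ γ) (L Z) 0 :=
    fun L hL => by
      have hd := hγ.hasFDerivAt
      have hw : HasFDerivWithinAt γ (ContinuousLinearMap.toSpanSingleton ℝ Z) {t | γ t ∈ M} 0 :=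
        hd.hasFDerivWithinAt
      have := (hL.comp 0 hw fun t ht => ht).hasFDerivAt hM
      simpa using this.hasDerivAt
  exact (aux _ hr.differentiableWithinAt.hasFDerivWithinAt).unique (aux _ hr)

/-- Stated for arbitrary normed spaces because the instance search behind
`DifferentiableAt.continuousAt` is expensive for maps between subspaces of matrices. -/
theorem continuousAt_of_differentiable {D : E → F →L[ℝ] G} (hD : Differentiable ℝ D) (x : E) :
    ContinuousAt D x :=
  (hD x).continuousAt

/-- If the derivative of `Ψ` at a zero `Y` is the identity, then near `0` the line `t ↦ t Z` lifts
along `Ψ` to a smooth curve through `Y` with velocity `Z`. -/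
theorem exists_curve_of_hasFDerivAt_id [CompleteSpace E] {Ψ : E → E} {Y : E}
    (hΨ : ContDiffAt ℝ ∞ Ψ Y) (hd : HasFDerivAt Ψ (ContinuousLinearMap.id ℝ E) Y) (h0 : Ψ Y = 0)
    (Z : E) : ∃ γ : ℝ → E, ContDiffAt ℝ ∞ γ 0 ∧ (∀ᶠ t in 𝓝 0, Ψ (γ t) = t • Z) ∧ γ 0 = Y ∧
      HasDerivAt γ Z 0 := by
  have hd' : HasFDerivAt Ψ ((ContinuousLinearEquiv.refl ℝ E : E ≃L[ℝ] E) : E →L[ℝ] E) Y := hd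
  have hs := hΨ.hasStrictFDerivAt' hd' (by simp)
  have hc := hΨ.to_localInverse hd' (by simp)
  have hl := hs.to_localInverse
  have hr := hs.eventually_right_inverse
  have hi := hs.localInverse_apply_image
  rw [h0] at hc hl hr hi
  have hline : HasDerivAt (fun t : ℝ => t • Z) Z 0 := by
    simpa using (hasDerivAt_id (0 : ℝ)).smul_const Z
  have ht : Filter.Tendsto (fun t : ℝ => t • Z) (𝓝 0) (𝓝 0) := by
    simpa using hline.continuousAt.tendsto
  refine ⟨fun t => hs.localInverse Ψ _ Y (t • Z), ?_, ht.eventually hr, by simpa using hi, ?_⟩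
  · refine ContDiffAt.comp (0 : ℝ) (f := fun t : ℝ => t • Z) ?_
      (contDiff_id.smul contDiff_const).contDiffAt
    rwa [zero_smul]
  · have hl' := hl.hasFDerivAt
    rw [← zero_smul ℝ Z] at hl'
    exact hl'.comp_hasDerivAt (0 : ℝ) hline

end Bilinear

namespace Constraint

variable {n p : ℕ} (P : Constraint n p)

/-! ### The bilinear maps behind the constraint -/

/-- The right action `(X, T) ↦ X T` of `𝒢` on `ℱ`, as a continuous bilinear map. -/
def act : P.F →L[ℝ] gram P.F →L[ℝ] P.F :=
  LinearMap.mkContinuous₂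
    (LinearMap.mk₂ ℝ (fun X T => ⟨mmul (X : Mat n p) (T : Mat p p), P.mmul_mem X X.2 T T.2⟩)
      (fun X X' T => Subtype.ext <| toMatrix_injective <| by simp [Matrix.add_mul])
      (fun c X T => Subtype.ext <| toMatrix_injective <| by simp)
      (fun X T T' => Subtype.ext <| toMatrix_injective <| by simp [Matrix.mul_add])
      (fun c X T => Subtype.ext <| toMatrix_injective <| by simp))
    1 fun X T => by simpa using norm_mmul_le (X : Mat n p) (T : Mat p p)

/-- The bilinear map `(X, Y) ↦ φ(X)ᵀ Y` from `ℱ × ℱ` to `𝒢`; the constraint is `pair X X = I`. -/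
def pair : P.F →L[ℝ] P.F →L[ℝ] gram P.F :=
  LinearMap.mkContinuous₂
    (LinearMap.mk₂ ℝ (fun X Y => ⟨mmul (mtr (P.φ X : Mat n p)) (Y : Mat n p),
        mtr_mmul_mem_gram (P.φ X) Y⟩)
      (fun X X' T => Subtype.ext <| toMatrix_injective <| by simp [Matrix.add_mul])
      (fun c X T => Subtype.ext <| toMatrix_injective <| by simp)
      (fun X T T' => Subtype.ext <| toMatrix_injective <| by simp [Matrix.mul_add])
      (fun c X T => Subtype.ext <| toMatrix_injective <| by simp))
    ‖LinearMap.toContinuousLinearMap P.φ‖ fun X Y => by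
      refine (norm_mmul_le _ _).trans ?_
      rw [norm_mtr]
      exact mul_le_mul_of_nonneg_right ((LinearMap.toContinuousLinearMap P.φ).le_opNorm X)
        (norm_nonneg _)

/-- The symmetrization `(X, Y) ↦ φ(X)ᵀ Y + φ(Y)ᵀ X`, the transpose of `DC(X)[Y]`. -/
def sym : P.F →L[ℝ] P.F →L[ℝ] gram P.F := P.pair + P.pair.flip

theorem coe_act (X : P.F) (T : gram P.F) :
    (P.act X T : Mat n p) = mmul (X : Mat n p) (T : Mat p p) := rfl

theorem coe_pair (X Y : P.F) :
    (P.pair X Y : Mat p p) = mmul (mtr (P.φ X : Mat n p)) (Y : Mat n p) := rfl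

theorem sym_apply (X Y : P.F) : P.sym X Y = P.pair X Y + P.pair Y X := rfl

/-- `φ(X T) = φ(X) ψ(T)`. -/
theorem φ_act (X : P.F) (T : gram P.F) : P.φ (P.act X T) = P.act (P.φ X) (P.ψ T) :=
  Subtype.ext (P.φ_mmul X T)

theorem norm_act_le (X : P.F) (T : gram P.F) : ‖P.act X T‖ ≤ ‖X‖ * ‖T‖ :=
  norm_mmul_le (X : Mat n p) (T : Mat p p)

theorem ψ_pair_self (X : P.F) : (P.ψ (P.pair X X) : Mat p p) = mtr (P.pair X X : Mat p p) := by
  refine (P.ψ_gram X).trans (toMatrix_injective ?_)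
  simp [coe_pair]

/-- Polarization of the assumption `ψ(φ(X)ᵀ X) = Xᵀ φ(X)`. -/
theorem ψ_sym (X Y : P.F) : (P.ψ (P.sym X Y) : Mat p p) = mtr (P.sym X Y : Mat p p) := by
  have h := P.ψ_pair_self (X + Y)
  have h1 := P.ψ_pair_self X
  have h2 := P.ψ_pair_self Y
  have e : P.pair (X + Y) (X + Y) = P.pair X X + P.pair Y Y + P.sym X Y := by
    simp only [map_add, add_apply, sym_apply]; abel
  rw [e] at h
  simp only [map_add, Submodule.coe_add, h1, h2] at h
  exact add_left_cancel h

theorem C_eq (X : P.F) : P.C X = mtr (P.pair X X : Mat p p) - mone p :=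
  toMatrix_injective <| by simp [C, coe_pair]

theorem A_eq (X : P.F) : P.A X = (3 / 2 : ℝ) • X - (1 / 2 : ℝ) • P.act X (P.pair X X) := rfl

/-- `φ(X T)ᵀ Y = T φ(X)ᵀ Y` when `ψ(T) = Tᵀ`. -/
theorem coe_pair_act_left (X Y : P.F) {T : gram P.F}
    (hT : (P.ψ T : Mat p p) = mtr (T : Mat p p)) :
    (P.pair (P.act X T) Y : Mat p p) = mmul (T : Mat p p) (P.pair X Y : Mat p p) := by
  refine toMatrix_injective ?_
  simp [coe_pair, φ_act, coe_act, hT, Matrix.mul_assoc]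

theorem coe_pair_act_right (X Y : P.F) (T : gram P.F) :
    (P.pair X (P.act Y T) : Mat p p) = mmul (P.pair X Y : Mat p p) (T : Mat p p) := by
  refine toMatrix_injective ?_
  simp [coe_pair, coe_act, Matrix.mul_assoc]

/-! ### Differentials of `C` and `𝒜` -/

/-- Transposition on `𝒢`. -/
def mtrGram : gram P.F →L[ℝ] Mat p p :=
  (LinearMap.toContinuousLinearMap (mtr : Mat p p →ₗ[ℝ] Mat p p)).comp (gram P.F).subtypeL

/-- The differential of `C` at `X`. -/
def dC (X : P.F) : P.F →L[ℝ] Mat p p := P.mtrGram.comp (P.sym X)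

theorem dC_apply (X Z : P.F) : P.dC X Z = mtr (P.sym X Z : Mat p p) := rfl

theorem dC_eq_zero_iff (X Z : P.F) : P.dC X Z = 0 ↔ P.sym X Z = 0 := by
  rw [dC_apply, ← norm_eq_zero, norm_mtr, norm_eq_zero, ZeroMemClass.coe_eq_zero]

/-- The differential of `𝒜` at `X`. -/
def dA (X : P.F) : P.F →L[ℝ] P.F :=
  (3 / 2 : ℝ) • ContinuousLinearMap.id ℝ P.F
    - (1 / 2 : ℝ) • (P.act.flip (P.pair X X) + (P.act X).comp (P.sym X))

theorem dA_apply (X Z : P.F) : P.dA X Z =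
    (3 / 2 : ℝ) • Z - (1 / 2 : ℝ) • (P.act Z (P.pair X X) + P.act X (P.sym X Z)) := rfl

theorem hasFDerivAt_pair_self (X : P.F) : HasFDerivAt (fun x => P.pair x x) (P.sym X) X :=
  hasFDerivAt_bilinear_diag P.pair X

theorem hasFDerivAt_C (X : P.F) : HasFDerivAt P.C (P.dC X) X := by
  rw [show P.C = fun x => P.mtrGram (P.pair x x) - mone p from funext P.C_eq]
  exact (hasFDerivAt_clm_comp P.mtrGram (P.hasFDerivAt_pair_self X)).sub_const (mone p)

theorem hasFDerivAt_A (X : P.F) : HasFDerivAt P.A (P.dA X) X := by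
  rw [show P.A = fun x => (3 / 2 : ℝ) • x - (1 / 2 : ℝ) • P.act x (P.pair x x) from
    funext P.A_eq]
  exact ((hasFDerivAt_id X).const_smul (3 / 2 : ℝ)).sub
    ((hasFDerivAt_bilinear_id P.act (P.hasFDerivAt_pair_self X)).const_smul (1 / 2 : ℝ))

theorem contDiff_pair_self : ContDiff ℝ ∞ fun x => P.pair x x :=
  contDiff_bilinear_diag P.pair

theorem differentiable_dC : Differentiable ℝ P.dC :=
  differentiable_clm_comp_right P.mtrGram P.sym

theorem differentiable_dA : Differentiable ℝ P.dA := fun X =>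
  differentiableAt_cubic_fderiv P.act P.sym (P.hasFDerivAt_pair_self X).differentiableAt

/-! ### Algebra at feasible points -/

variable {P} {Y : P.F}

theorem coe_pair_self_of_mem (hY : Y ∈ P.M) : (P.pair Y Y : Mat p p) = mone p := by
  have h : mtr (mmul (mtr (Y : Mat n p)) (P.φ Y : Mat n p)) = mtr (mone p) := congrArg mtr hY
  refine toMatrix_injective ?_
  have := congrArg toMatrix h
  simpa [coe_pair] using this

theorem mem_M_iff_C_eq_zero : Y ∈ P.M ↔ P.C Y = 0 := sub_eq_zero.symm

theorem act_pair_self_of_mem (hY : Y ∈ P.M) (Z : P.F) : P.act Z (P.pair Y Y) = Z := by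
  refine Subtype.ext (toMatrix_injective ?_)
  simp [coe_act, coe_pair_self_of_mem hY]

theorem A_of_mem (hY : Y ∈ P.M) : P.A Y = Y := by
  rw [A_eq, act_pair_self_of_mem hY]; module

theorem dA_of_mem (hY : Y ∈ P.M) (Z : P.F) :
    P.dA Y Z = Z - (1 / 2 : ℝ) • P.act Y (P.sym Y Z) := by
  rw [dA_apply, act_pair_self_of_mem hY]; module

/-- At a feasible point, `Y T / 2` is a preimage of `T` under `sym Y` for every `T` with
`ψ(T) = Tᵀ`; in particular `DC(Y)` maps onto `𝒮₁`. -/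
theorem sym_act_of_mem (hY : Y ∈ P.M) {T : gram P.F}
    (hT : (P.ψ T : Mat p p) = mtr (T : Mat p p)) : P.sym Y (P.act Y T) = (2 : ℝ) • T := by
  refine Subtype.ext (toMatrix_injective ?_)
  rw [sym_apply, Submodule.coe_add, coe_pair_act_left P Y Y hT, coe_pair_act_right]
  simp [coe_pair_self_of_mem hY, two_smul]

/-- At a feasible point, `D𝒜(Y)` maps into the kernel of `DC(Y)`. -/
theorem sym_dA_of_mem (hY : Y ∈ P.M) (Z : P.F) : P.sym Y (P.dA Y Z) = 0 := by
  rw [dA_of_mem hY, map_sub, map_smul, sym_act_of_mem hY (P.ψ_sym Y Z)]; module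

/-- At a feasible point, `D𝒜(Y)` is the identity on the kernel of `DC(Y)`. -/
theorem dA_eq_self_of_sym_eq_zero (hY : Y ∈ P.M) {Z : P.F} (hZ : P.sym Y Z = 0) :
    P.dA Y Z = Z := by
  rw [dA_of_mem hY, hZ]; simp

end Constraint

/-! ### Second-order calculus of the penalty function -/

section Penalty

open ContinuousLinearMap

variable {V W : Type*} [NormedAddCommGroup V] [InnerProductSpace ℝ V] [CompleteSpace V]
  [NormedAddCommGroup W] [InnerProductSpace ℝ W] [CompleteSpace W]

/-- The adjoint as a real-linear (rather than conjugate-linear) continuous map. -/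
def adjointCLM : (V →L[ℝ] W) →L[ℝ] (W →L[ℝ] V) :=
  LinearMap.mkContinuous
    { toFun := fun T => adjoint T
      map_add' := fun S T => map_add adjoint S T
      map_smul' := fun c T => by
        rw [LinearIsometryEquiv.map_smulₛₗ]; rfl }
    1 fun T => by
      rw [one_mul]; exact (LinearIsometryEquiv.norm_map adjoint T).le

theorem adjointCLM_apply (T : V →L[ℝ] W) : adjointCLM T = adjoint T := rfl

variable {f : V → ℝ} {A : V → V} {C : V → W} {dA : V → V →L[ℝ] V} {dC : V → V →L[ℝ] W}

theorem gradient_penalty (hf : Differentiable ℝ f) (hA : ∀ x, HasFDerivAt A (dA x) x)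
    (hC : ∀ x, HasFDerivAt C (dC x) x) (β : ℝ) :
    ∇ (fun x => f (A x) + β / 2 * ‖C x‖ ^ 2) =
      fun x => adjointCLM (dA x) (∇ f (A x)) + β • adjointCLM (dC x) (C x) := by
  refine gradient_eq fun x => ?_
  rw [hasGradientAt_iff_hasFDerivAt]
  have h1 := (hasGradientAt_iff_hasFDerivAt.1 (hf (A x)).hasGradientAt).comp x (hA x)
  have h2 := (hC x).norm_sq.const_mul (β / 2)
  refine (h1.add h2).congr_fderiv ?_
  ext v
  simp [adjointCLM_apply, adjoint_inner_left]
  ring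

theorem differentiable_gradient_penalty (hf : Differentiable ℝ f) (hf' : Differentiable ℝ (∇ f))
    (hA : ∀ x, HasFDerivAt A (dA x) x) (hC : ∀ x, HasFDerivAt C (dC x) x)
    (hdA : Differentiable ℝ dA) (hdC : Differentiable ℝ dC) (β : ℝ) :
    Differentiable ℝ (∇ (fun x => f (A x) + β / 2 * ‖C x‖ ^ 2)) := by
  rw [gradient_penalty hf hA hC]
  have dA' : Differentiable ℝ A := fun x => (hA x).differentiableAt
  have dC' : Differentiable ℝ C := fun x => (hC x).differentiableAt
  have h1 : Differentiable ℝ fun x => adjointCLM (dA x) :=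
    fun x => (adjointCLM (V := V) (W := V)).differentiableAt.comp x (hdA x)
  have h2 : Differentiable ℝ fun x => adjointCLM (dC x) :=
    fun x => (adjointCLM (V := V) (W := W)).differentiableAt.comp x (hdC x)
  exact (h1.clm_apply (hf'.comp dA')).add ((h2.clm_apply dC').const_smul β)

/-- The quadratic form of the Hessian of `f ∘ A + (β / 2) ‖C‖²`. -/
theorem inner_fderiv_gradient_penalty (hf : Differentiable ℝ f) (hf' : Differentiable ℝ (∇ f))
    (hA : ∀ x, HasFDerivAt A (dA x) x) (hC : ∀ x, HasFDerivAt C (dC x) x)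
    (hdA : Differentiable ℝ dA) (hdC : Differentiable ℝ dC) (β : ℝ) (x z : V) :
    ⟪z, fderiv ℝ (∇ (fun x => f (A x) + β / 2 * ‖C x‖ ^ 2)) x z⟫_ℝ =
      ⟪dA x z, fderiv ℝ (∇ f) (A x) (dA x z)⟫_ℝ + ⟪∇ f (A x), fderiv ℝ dA x z z⟫_ℝ
        + β * (‖dC x z‖ ^ 2 + ⟪fderiv ℝ dC x z z, C x⟫_ℝ) := by
  have h0 := (differentiable_gradient_penalty hf hf' hA hC hdA hdC β x).hasFDerivAt
  have hl := (innerSL ℝ z).hasFDerivAt.comp x h0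
  -- The derivative of `y ↦ ⟪z, ∇h(y)⟫` is computed a second time by the product rule.
  have e : (⇑(innerSL ℝ z) ∘ ∇ (fun x => f (A x) + β / 2 * ‖C x‖ ^ 2)) =
      fun y => ⟪dA y z, ∇ f (A y)⟫_ℝ + β * ⟪dC y z, C y⟫_ℝ := by
    rw [gradient_penalty hf hA hC]
    ext y
    simp [adjointCLM_apply, adjoint_inner_right, inner_add_right, inner_smul_right]
  rw [e] at hl
  have hAz : HasFDerivAt (fun y => dA y z) ((fderiv ℝ dA x).flip z) x := by
    refine ((hdA x).hasFDerivAt.clm_apply (hasFDerivAt_const z x)).congr_fderiv ?_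
    ext v; simp
  have hCz : HasFDerivAt (fun y => dC y z) ((fderiv ℝ dC x).flip z) x := by
    refine ((hdC x).hasFDerivAt.clm_apply (hasFDerivAt_const z x)).congr_fderiv ?_
    ext v; simp
  have hg := ((hf' (A x)).hasFDerivAt).comp x (hA x)
  have h2 := (hAz.inner ℝ hg).add ((hCz.inner ℝ (hC x)).const_mul β)
  have := DFunLike.congr_fun (hl.unique h2) z
  simp only [coe_comp, Function.comp_apply, innerSL_apply_apply] at this
  rw [this]
  simp [real_inner_comm, fderivInnerCLM_apply]

end Penalty

/-! ### Orthogonal projections along an idempotent field -/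

section Projection

open ContinuousLinearMap

variable {V : Type*} [NormedAddCommGroup V] [InnerProductSpace ℝ V] [FiniteDimensional ℝ V]

/-- If `E` is a linear projection onto `T` and `P` is the orthogonal projection onto `T`, then
`P (E + E* - 1) = E`. -/
theorem starProjection_mul_add_adjoint_sub_one (T : Submodule ℝ V) (E : V →L[ℝ] V)
    (h1 : ∀ v, E v ∈ T) (h2 : ∀ v ∈ T, E v = v) :
    T.starProjection * (E + adjointCLM E - 1) = E := by
  have hPE : ∀ v, T.starProjection (E v) = E v := fun v =>
    Submodule.starProjection_eq_self_iff.2 (h1 v)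
  ext v
  refine ext_inner_right ℝ fun w => ?_
  have : ⟪T.starProjection (adjointCLM E v), w⟫_ℝ = ⟪T.starProjection v, w⟫_ℝ := by
    rw [Submodule.inner_starProjection_left_eq_right, adjointCLM_apply, adjoint_inner_left,
      h2 _ (Submodule.starProjection_apply_mem T w), Submodule.inner_starProjection_left_eq_right]
  change ⟪T.starProjection (E v + adjointCLM E v - v), w⟫_ℝ = _
  rw [map_sub, map_add, inner_sub_left, inner_add_left, this, hPE]
  ring

/-- If `E` is a linear projection then `E + E* - 1` is invertible. -/
theorem isUnit_add_adjoint_sub_one (T : Submodule ℝ V) (E : V →L[ℝ] V)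
    (h1 : ∀ v, E v ∈ T) (h2 : ∀ v ∈ T, E v = v) : IsUnit (E + adjointCLM E - 1) := by
  have hinj : Function.Injective (E + adjointCLM E - 1 : V →L[ℝ] V) := by
    refine (injective_iff_map_eq_zero _).2 fun v hv => ?_
    have hE : E v = 0 := by
      rw [← starProjection_mul_add_adjoint_sub_one T E h1 h2]
      exact (congrArg T.starProjection hv).trans (map_zero _)
    -- `v = E* v` with `E v = 0` is orthogonal to itself.
    have hE' : adjointCLM E v = v := by
      simpa [hE, sub_eq_zero] using hv
    rw [← inner_self_eq_zero (𝕜 := ℝ)]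
    nth_rewrite 1 [← hE']
    rw [adjointCLM_apply, adjoint_inner_left, hE, inner_zero_right]
  rw [ContinuousLinearMap.isUnit_iff_bijective]
  exact ⟨hinj, (LinearMap.injective_iff_surjective
    (f := (E + adjointCLM E - 1 : V →L[ℝ] V).toLinearMap)).1 hinj⟩

/-- Orthogonal projections onto the ranges of a continuous field of (oblique) projections depend
continuously on the point. -/
theorem continuousWithinAt_starProjection {M : Set V} {T : V → Submodule ℝ V}
    {E : V → V →L[ℝ] V} (h1 : ∀ x ∈ M, ∀ v, E x v ∈ T x) (h2 : ∀ x ∈ M, ∀ v ∈ T x, E x v = v)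
    {Y : V} (hY : Y ∈ M) (hE : ContinuousAt E Y) :
    ContinuousWithinAt (fun x => (T x).starProjection) M Y := by
  have key : ∀ x ∈ M, (T x).starProjection = E x * Ring.inverse (E x + adjointCLM (E x) - 1) := by
    intro x hx
    have hu := isUnit_add_adjoint_sub_one (T x) (E x) (h1 x hx) (h2 x hx)
    exact (Ring.eq_mul_inverse_iff_mul_eq _ _ _ hu).2
      (starProjection_mul_add_adjoint_sub_one (T x) (E x) (h1 x hx) (h2 x hx))
  refine ContinuousWithinAt.congr (ContinuousAt.continuousWithinAt ?_) key (key Y hY)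
  obtain ⟨u, hu⟩ := isUnit_add_adjoint_sub_one (T Y) (E Y) (h1 Y hY) (h2 Y hY)
  have hJ : ContinuousAt (fun x => E x + adjointCLM (E x) - 1) Y :=
    (hE.add (adjointCLM.continuous.continuousAt.comp hE)).sub continuousAt_const
  have hi : ContinuousAt Ring.inverse (E Y + adjointCLM (E Y) - 1) :=
    hu ▸ NormedRing.inverse_continuousAt u
  exact hE.mul (hi.comp (f := fun x => E x + adjointCLM (E x) - 1) hJ)

/-- The derivative along `M` of a tangential projection `P g`, at a zero of the field
`k = E* g`. No derivative of `P` enters, because `P g = P k` on `M`. -/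
theorem hasFDerivWithinAt_starProjection_apply {M : Set V} {T : V → Submodule ℝ V}
    {E : V → V →L[ℝ] V} (h1 : ∀ x ∈ M, ∀ v, E x v ∈ T x) (h2 : ∀ x ∈ M, ∀ v ∈ T x, E x v = v)
    {Y : V} (hY : Y ∈ M) (hE : ContinuousAt E Y) {g k : V → V} {k' : V →L[ℝ] V}
    (hk : HasFDerivAt k k' Y) (hgk : ∀ x ∈ M, k x = adjointCLM (E x) (g x)) (h0 : k Y = 0) :
    HasFDerivWithinAt (fun x => (T x).starProjection (g x)) ((T Y).starProjection.comp k')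
      M Y := by
  have e : ∀ x ∈ M, (T x).starProjection (g x) = (T x).starProjection (k x) := by
    intro x hx
    refine ext_inner_right ℝ fun w => ?_
    rw [hgk x hx, Submodule.inner_starProjection_left_eq_right,
      Submodule.inner_starProjection_left_eq_right, adjointCLM_apply, adjoint_inner_left,
      h2 x hx _ (Submodule.starProjection_apply_mem _ w)]
  exact (hasFDerivWithinAt_clm_apply_of_eq_zero
    (continuousWithinAt_starProjection h1 h2 hY hE) hk.hasFDerivWithinAt h0).congr e (e Y hY)

end Projection

namespace Constraint

variable {n p : ℕ} {P : Constraint n p}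

/-! ### Tangent spaces, Riemannian gradient and Hessian -/

theorem mem_M_iff {Y : P.F} : Y ∈ P.M ↔ (P.pair Y Y : Mat p p) = mone p := by
  refine ⟨coe_pair_self_of_mem, fun h => ?_⟩
  rw [mem_M_iff_C_eq_zero, C_eq, h]
  exact toMatrix_injective (by simp)

/-- A chart of `ℱ` at the feasible point `Y` that straightens `ℳ`: it has derivative `id` at `Y`,
and `DC(Y)` carries it to `C`. -/
def straighten (Y x : P.F) : P.F :=
  (ContinuousLinearMap.id ℝ P.F - (1 / 2 : ℝ) • (P.act Y).comp (P.sym Y)) (x - Y)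
    + ((1 / 2 : ℝ) • P.act Y) (P.pair x x - P.pair Y Y)

theorem hasFDerivAt_straighten (Y : P.F) :
    HasFDerivAt (straighten Y) (ContinuousLinearMap.id ℝ P.F) Y := by
  have h1 := hasFDerivAt_clm_comp
    (ContinuousLinearMap.id ℝ P.F - (1 / 2 : ℝ) • (P.act Y).comp (P.sym Y))
    ((hasFDerivAt_id Y).sub_const Y)
  have h2 := hasFDerivAt_clm_comp ((1 / 2 : ℝ) • P.act Y)
    ((P.hasFDerivAt_pair_self Y).sub_const (P.pair Y Y))
  refine (h1.add h2).congr_fderiv ?_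
  ext1 Z
  simp

theorem contDiff_straighten (Y : P.F) : ContDiff ℝ ∞ (straighten Y) :=
  ((ContinuousLinearMap.contDiff _).comp (contDiff_id.sub contDiff_const)).add
    ((ContinuousLinearMap.contDiff _).comp (P.contDiff_pair_self.sub contDiff_const))

theorem sym_straighten {Y : P.F} (hY : Y ∈ P.M) (x : P.F) :
    P.sym Y (straighten Y x) = P.pair x x - P.pair Y Y := by
  have e : straighten Y x = (x - Y) - (1 / 2 : ℝ) • P.act Y (P.sym Y (x - Y))
      + (1 / 2 : ℝ) • (P.act Y (P.pair x x) - P.act Y (P.pair Y Y)) := by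
    rw [← map_sub]; rfl
  rw [e, map_add, map_sub, map_smul, map_smul, map_sub (P.sym Y) (P.act Y _),
    sym_act_of_mem hY (P.ψ_sym _ _), sym_act_of_mem hY (P.ψ_pair_self _),
    sym_act_of_mem hY (P.ψ_pair_self _)]
  module

/-- The tangent space of `ℳ` is the kernel of `DC`. -/
theorem mem_tangentSpace_iff {Y : P.F} (hY : Y ∈ P.M) {Z : P.F} :
    Z ∈ P.tangentSpace Y ↔ P.sym Y Z = 0 := by
  constructor
  · intro hZ
    induction hZ using Submodule.span_induction with
    | mem Z hZ =>
      obtain ⟨γ, -, hM, h0, hγ⟩ := hZ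
      have h1 : HasDerivAt (fun t => P.C (γ t)) (P.dC Y Z) 0 :=
        HasFDerivAt.comp_hasDerivAt_of_eq (0 : ℝ) (P.hasFDerivAt_C Y) hγ h0.symm
      have h2 : (fun t => P.C (γ t)) =ᶠ[𝓝 0] fun _ => 0 := by
        filter_upwards [hM] with t ht using mem_M_iff_C_eq_zero.1 ht
      exact (P.dC_eq_zero_iff Y Z).1
        (h1.unique ((hasDerivAt_const (0 : ℝ) (0 : Mat p p)).congr_of_eventuallyEq h2))
    | zero => exact map_zero _
    | add x y _ _ hx hy => rw [map_add, hx, hy, add_zero]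
    | smul c x _ hx => rw [map_smul, hx, smul_zero]
  · intro hZ
    obtain ⟨γ, h1, h2, h3, h4⟩ := exists_curve_of_hasFDerivAt_id
      (contDiff_straighten Y).contDiffAt (hasFDerivAt_straighten Y)
      (show straighten Y Y = 0 by simp [straighten]) Z
    refine Submodule.subset_span ⟨γ, h1, ?_, h3, h4⟩
    filter_upwards [h2] with t ht
    have := sym_straighten hY (γ t)
    rw [ht, map_smul, hZ, smul_zero, eq_comm, sub_eq_zero] at this
    rw [mem_M_iff, this, coe_pair_self_of_mem hY]

variable {f : P.F → ℝ}

theorem gradient_cdf (hf : Differentiable ℝ f) (β : ℝ) : ∇ (P.cdf f β) =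
    fun x => adjointCLM (P.dA x) (∇ f (P.A x)) + β • adjointCLM (P.dC x) (P.C x) :=
  gradient_penalty hf P.hasFDerivAt_A P.hasFDerivAt_C β

theorem differentiable_gradient_cdf (hf : Differentiable ℝ f) (hf' : Differentiable ℝ (∇ f))
    (β : ℝ) : Differentiable ℝ (∇ (P.cdf f β)) :=
  differentiable_gradient_penalty hf hf' P.hasFDerivAt_A P.hasFDerivAt_C P.differentiable_dA
    P.differentiable_dC β

/-- The second differential `D²𝒜(Y)[Z, Z]`. -/
def d2A (P : Constraint n p) (Y Z : P.F) : P.F :=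
  -P.act Z (P.sym Y Z) - (1 / 2 : ℝ) • P.act Y (P.sym Z Z)

/-- The quadratic form of the Hessian of `h` at a feasible point. -/
theorem inner_hessian_cdf_of_mem (hf : Differentiable ℝ f) (hf' : Differentiable ℝ (∇ f))
    (β : ℝ) {Y : P.F} (hY : Y ∈ P.M) (Z : P.F) :
    ⟪Z, fderiv ℝ (∇ (P.cdf f β)) Y Z⟫_ℝ =
      ⟪P.dA Y Z, fderiv ℝ (∇ f) Y (P.dA Y Z)⟫_ℝ + ⟪∇ f Y, P.d2A Y Z⟫_ℝ
        + β * ‖P.sym Y Z‖ ^ 2 := by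
  have h := inner_fderiv_gradient_penalty hf hf' P.hasFDerivAt_A P.hasFDerivAt_C
    P.differentiable_dA P.differentiable_dC β Y Z
  have hA : fderiv ℝ P.dA Y Z Z = P.d2A Y Z :=
    fderiv_cubic_fderiv_apply P.act P.sym (P.hasFDerivAt_pair_self Y) Z
  rw [A_of_mem hY, hA, mem_M_iff_C_eq_zero.1 hY, inner_zero_right, add_zero, dC_apply,
    norm_mtr] at h
  exact h

theorem inner_gradient_cdf_of_mem (hf : Differentiable ℝ f) (β : ℝ) {Y : P.F} (hY : Y ∈ P.M)
    (Z : P.F) : ⟪∇ (P.cdf f β) Y, Z⟫_ℝ = ⟪∇ f Y, P.dA Y Z⟫_ℝ := by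
  rw [gradient_cdf hf]
  simp only [mem_M_iff_C_eq_zero.1 hY, map_zero, smul_zero, add_zero, A_of_mem hY]
  rw [adjointCLM_apply, ContinuousLinearMap.adjoint_inner_left]

theorem rgrad_eq_zero_iff {Y : P.F} (hY : Y ∈ P.M) :
    P.rgrad f Y = 0 ↔ ∀ W, P.sym Y W = 0 → ⟪∇ f Y, W⟫_ℝ = 0 := by
  rw [rgrad, Submodule.starProjection_apply_eq_zero_iff, Submodule.mem_orthogonal']
  simp only [mem_tangentSpace_iff hY]

/-- `∇h(Y) = 0` at a feasible point is first-order stationarity on `ℳ`. -/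
theorem gradient_cdf_eq_zero_iff_of_mem (hf : Differentiable ℝ f) (β : ℝ) {Y : P.F}
    (hY : Y ∈ P.M) : ∇ (P.cdf f β) Y = 0 ↔ P.rgrad f Y = 0 := by
  rw [rgrad_eq_zero_iff hY]
  constructor
  · intro h W hW
    rw [← dA_eq_self_of_sym_eq_zero hY hW, ← inner_gradient_cdf_of_mem hf β hY, h,
      inner_zero_left]
  · intro h
    refine ext_inner_right ℝ fun Z => ?_
    rw [inner_gradient_cdf_of_mem hf β hY, h _ (sym_dA_of_mem hY Z), inner_zero_left]

/-- On the tangent space at a stationary point, the Riemannian Hessian of `f` and the Hessian of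
`f ∘ 𝒜` have the same quadratic form. -/
theorem inner_rhess (hf : Differentiable ℝ f) (hf' : Differentiable ℝ (∇ f)) {Y : P.F}
    (hY : Y ∈ P.M) (hg : P.rgrad f Y = 0) {Z : P.F} (hZ : Z ∈ P.tangentSpace Y) :
    ⟪Z, P.rhess f Y Z⟫_ℝ = ⟪Z, fderiv ℝ (∇ (P.cdf f 0)) Y Z⟫_ℝ := by
  have hk := (differentiable_gradient_cdf hf hf' 0 Y).hasFDerivAt
  have hr := hasFDerivWithinAt_starProjection_apply (M := P.M) (T := P.tangentSpace) (E := P.dA)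
    (fun x hx v => (mem_tangentSpace_iff hx).2 (sym_dA_of_mem hx v))
    (fun x hx v hv => dA_eq_self_of_sym_eq_zero hx ((mem_tangentSpace_iff hx).1 hv))
    hY (continuousAt_of_differentiable P.differentiable_dA Y) (g := ∇ f) hk
    (fun x hx => ext_inner_right ℝ fun v => by
      rw [inner_gradient_cdf_of_mem hf 0 hx, adjointCLM_apply,
        ContinuousLinearMap.adjoint_inner_left])
    ((gradient_cdf_eq_zero_iff_of_mem hf 0 hY).2 hg)
  have hfd : fderivWithin ℝ (P.rgrad f) P.M Y Z =
      (P.tangentSpace Y).starProjection (fderiv ℝ (∇ (P.cdf f 0)) Y Z) := by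
    have hspan := hZ
    induction hspan using Submodule.span_induction with
    | mem Z h =>
      obtain ⟨γ, -, hM, h0, hγ⟩ := h
      exact fderivWithin_apply_of_curve hr hM h0 hγ
    | zero => simp
    | add x y hx hy h1 h2 => rw [map_add, h1 hx, h2 hy, map_add, map_add]
    | smul c x hx h1 => rw [map_smul, h1 hx, map_smul, map_smul]
  rw [rhess, hfd, ← Submodule.inner_starProjection_left_eq_right,
    ← Submodule.inner_starProjection_left_eq_right, Submodule.starProjection_eq_self_iff.2 hZ,
    Submodule.starProjection_eq_self_iff.2 hZ]

/-- `real_inner_smul_left`, with the scalar multiplication of `ℱ` as a submodule. -/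
theorem inner_smul_left' (c : ℝ) (X Y : P.F) : ⟪c • X, Y⟫_ℝ = c * ⟪X, Y⟫_ℝ :=
  real_inner_smul_left X Y c

/-- `real_inner_smul_right`, with the scalar multiplication of `ℱ` as a submodule. -/
theorem inner_smul_right' (c : ℝ) (X Y : P.F) : ⟪X, c • Y⟫_ℝ = c * ⟪X, Y⟫_ℝ :=
  real_inner_smul_right X Y c

/-! ### The normal directions at a stationary point -/

/-- At a stationary point the gradient sees the difference of `D²𝒜(Y)` at `Z` and at its
tangential part only through the square of `S = DC(Y)[Z]ᵀ`: the terms mixing the tangential and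
normal parts of `Z` are tangent to `ℳ`. -/
theorem inner_d2A_sub {Y : P.F} (hY : Y ∈ P.M) (hg : P.rgrad f Y = 0) (Z : P.F) :
    ⟪∇ f Y, P.d2A Y Z⟫_ℝ - ⟪∇ f Y, P.d2A Y (P.dA Y Z)⟫_ℝ =
      -(3 / 4) * ⟪∇ f Y, P.act (P.act Y (P.sym Y Z)) (P.sym Y Z)⟫_ℝ := by
  set S := P.sym Y Z with hS
  set Z₁ := P.dA Y Z with hZ₁
  set V := P.act Y S with hV
  have hψ : (P.ψ S : Mat p p) = mtr (S : Mat p p) := P.ψ_sym Y Z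
  have h1 : P.sym Y Z₁ = 0 := sym_dA_of_mem hY Z
  have hZ : Z = Z₁ + (1 / 2 : ℝ) • V := by rw [hZ₁, dA_of_mem hY]; module
  have hsymV : P.sym V V = (2 : ℝ) • P.pair V V := by rw [sym_apply]; module
  have hsymZ : P.sym Z Z = P.sym Z₁ Z₁ + P.sym Z₁ V + (1 / 2 : ℝ) • P.pair V V := by
    have hc : P.sym V Z₁ = P.sym Z₁ V := by rw [sym_apply, sym_apply, add_comm]
    rw [hZ]
    simp only [map_add, map_smul, add_apply, FunLike.coe_smul, Pi.smul_apply, hsymV, hc]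
    module
  have hVV : P.act Y (P.pair V V) = P.act V S := by
    refine Subtype.ext (toMatrix_injective ?_)
    rw [coe_act, hV, coe_pair_act_left P _ _ hψ, coe_pair_act_right, coe_pair_self_of_mem hY]
    simp [coe_act, Matrix.mul_assoc]
  have hU : P.sym Y (P.act Z₁ S) = -P.sym Z₁ V := by
    have h1' : (P.pair Z₁ Y : Mat p p) = -(P.pair Y Z₁ : Mat p p) := by
      rw [sym_apply, add_comm] at h1
      exact congrArg Subtype.val (eq_neg_of_add_eq_zero_left h1)
    refine Subtype.ext (toMatrix_injective ?_)
    rw [sym_apply, sym_apply, hV, Submodule.coe_add, Submodule.coe_neg, Submodule.coe_add,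
      coe_pair_act_right, coe_pair_act_right, coe_pair_act_left P _ _ hψ,
      coe_pair_act_left P _ _ hψ, h1']
    simp only [toMatrix_add, toMatrix_neg, toMatrix_mmul, Matrix.mul_neg,
      Matrix.neg_mul]
    abel
  -- The mixed terms form a tangent vector, which the gradient annihilates.
  have htan := (rgrad_eq_zero_iff hY).1 hg
    (P.act Z₁ S + (1 / 2 : ℝ) • P.act Y (P.sym Z₁ V)) (by
      rw [map_add, map_smul, hU, sym_act_of_mem hY (P.ψ_sym _ _)]; module)
  have hdiff : P.d2A Y Z - P.d2A Y Z₁ =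
      -(P.act Z₁ S + (1 / 2 : ℝ) • P.act Y (P.sym Z₁ V)) - (3 / 4 : ℝ) • P.act V S := by
    have e : P.act Z S = P.act Z₁ S + (1 / 2 : ℝ) • P.act V S := by
      conv_lhs => rw [hZ]
      rw [map_add, map_smul]; rfl
    rw [d2A, d2A, h1, ← hS, e, hsymZ, map_add, map_add, map_smul, hVV, map_zero]
    module
  rw [← inner_sub_right, hdiff, inner_sub_right, inner_neg_right, htan, inner_smul_right']
  ring

/-! ### Infeasible points -/

/-- The first-order test: `∇h(Y)` is paired with the normal direction `Y C(Y)ᵀ`. -/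
theorem inner_gradient_cdf_test (hf : Differentiable ℝ f) (β : ℝ) (Y : P.F) :
    ∃ V : P.F, ‖V‖ ≤ ‖Y‖ * ‖P.C Y‖ ^ 2 ∧
      ⟪∇ (P.cdf f β) Y, P.act Y (P.pair Y Y) - Y⟫_ℝ = -(3 / 2) * ⟪∇ f (P.A Y), V⟫_ℝ
        + 2 * β * (‖P.C Y‖ ^ 2 + ⟪P.C Y, mmul (P.C Y) (P.C Y)⟫_ℝ) := by
  set K := P.pair Y Y with hK
  set Z := P.act Y K - Y with hZ
  have hψ : (P.ψ K : Mat p p) = mtr (K : Mat p p) := P.ψ_pair_self Y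
  have hC : P.C Y = mtr (K : Mat p p) - mone p := P.C_eq Y
  have hsym : (P.sym Y Z : Mat p p) = (2 : ℝ) • (mmul (K : Mat p p) (K : Mat p p) - K) := by
    rw [hZ, map_sub, sym_apply, sym_apply, AddSubgroupClass.coe_sub, Submodule.coe_add,
      Submodule.coe_add, coe_pair_act_left P _ _ hψ, coe_pair_act_right, ← hK]
    module
  refine ⟨P.act Z K - Z, ?_, ?_⟩
  · have e : ((P.act Z K - Z : P.F) : Mat n p) =
        mmul (Y : Mat n p) (mtr (mmul (P.C Y) (P.C Y))) := by
      refine toMatrix_injective ?_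
      rw [hC]
      simp only [AddSubgroupClass.coe_sub, coe_act, hZ, toMatrix_sub, toMatrix_mmul, toMatrix_mtr,
        toMatrix_mone, Matrix.transpose_mul, Matrix.transpose_sub, Matrix.transpose_transpose,
        Matrix.transpose_one, Matrix.mul_sub, Matrix.sub_mul, Matrix.mul_assoc, Matrix.mul_one,
        Matrix.one_mul]
    rw [pow_two]
    refine (congrArg norm e).le.trans ((norm_mmul_le _ _).trans ?_)
    rw [norm_mtr]
    exact mul_le_mul_of_nonneg_left (norm_mmul_le _ _) (norm_nonneg _)
  · have hdA : P.dA Y Z = -(3 / 2 : ℝ) • (P.act Z K - Z) := by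
      refine Subtype.ext (toMatrix_injective ?_)
      rw [dA_apply]
      simp only [Submodule.coe_smul, AddSubgroupClass.coe_sub, Submodule.coe_add, coe_act, hsym]
      simp only [toMatrix_sub, toMatrix_add, toMatrix_smul, toMatrix_mmul, hZ, coe_act, hK,
        AddSubgroupClass.coe_sub, Matrix.mul_sub, Matrix.sub_mul, Matrix.mul_smul,
        Matrix.mul_assoc]
      module
    have hdC : P.dC Y Z = (2 : ℝ) • (P.C Y + mmul (P.C Y) (P.C Y)) := by
      rw [dC_apply, hsym, hC]
      refine toMatrix_injective ?_
      simp only [toMatrix_sub, toMatrix_add, toMatrix_smul, toMatrix_mmul, toMatrix_mtr,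
        toMatrix_mone, Matrix.transpose_mul, Matrix.transpose_sub, Matrix.transpose_smul,
        Matrix.mul_sub, Matrix.sub_mul, Matrix.mul_one, Matrix.one_mul]
      module
    rw [gradient_cdf hf, inner_add_left, inner_smul_left', adjointCLM_apply, adjointCLM_apply,
      ContinuousLinearMap.adjoint_inner_left, ContinuousLinearMap.adjoint_inner_left, hdA, hdC,
      inner_smul_right', real_inner_smul_right, inner_add_right, real_inner_self_eq_norm_sq]
    ring

end Constraint

/-! ### The constants -/

theorem mone_ne_zero {p : ℕ} (hp : p ≠ 0) : mone p ≠ 0 := by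
  intro h
  have := congrFun (congrFun (congrArg toMatrix h) ⟨0, hp.pos⟩) ⟨0, hp.pos⟩
  simp at this

theorem singularValues_le {E F : Type*} [NormedAddCommGroup E] [InnerProductSpace ℝ E]
    [FiniteDimensional ℝ E] [NormedAddCommGroup F] [InnerProductSpace ℝ F]
    [FiniteDimensional ℝ F] (T : E →ₗ[ℝ] F) {K : ℝ} (hK : 0 ≤ K) (hT : ∀ x, ‖T x‖ ≤ K * ‖x‖)
    (i : ℕ) : T.singularValues i ≤ K := by
  by_cases hi : i < Module.finrank ℝ E
  · obtain ⟨v, hv⟩ := (T.hasEigenvalue_adjoint_comp_self_sq_singularValues hi).exists_hasEigenvector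
    have hv0 : 0 < ‖v‖ := norm_pos_iff.2 hv.2
    have h1 : ‖T v‖ ^ 2 = T.singularValues i ^ 2 * ‖v‖ ^ 2 := by
      rw [← real_inner_self_eq_norm_sq, ← LinearMap.adjoint_inner_left]
      have := hv.apply_eq_smul
      rw [LinearMap.comp_apply] at this
      rw [this, real_inner_smul_left, real_inner_self_eq_norm_sq]
      rfl
    have h2 : T.singularValues i * ‖v‖ ≤ K * ‖v‖ := by
      refine le_trans (le_of_sq_le_sq ?_ (norm_nonneg _)) (hT v)
      rw [mul_pow, h1]
    exact le_of_mul_le_mul_right h2 hv0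
  · rw [T.singularValues_of_finrank_le (not_lt.1 hi)]
    exact hK

namespace Constraint

variable {n p : ℕ} {P : Constraint n p}

theorem norm_φ_le (Y : P.F) : ‖P.φ Y‖ ≤ P.Lphi * ‖Y‖ := by
  by_cases hY : Y = 0
  · simp [hY]
  have hY' : 0 < ‖Y‖ := norm_pos_iff.2 hY
  rw [← div_le_iff₀ hY']
  refine le_csSup ⟨‖LinearMap.toContinuousLinearMap P.φ‖, ?_⟩ ⟨Y, 0, hY, by simp⟩
  rintro r ⟨Y₁, Y₂, hne, rfl⟩
  rw [div_le_iff₀ (norm_pos_iff.2 (sub_ne_zero.2 hne)), ← map_sub]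
  exact (LinearMap.toContinuousLinearMap P.φ).le_opNorm _

theorem Lphi_nonneg : 0 ≤ P.Lphi :=
  Real.sSup_nonneg fun r ⟨_, _, _, h⟩ => h ▸ by positivity

theorem Lphi_pos {X : P.F} (hX : X ≠ 0) : 0 < P.Lphi := by
  have h : 0 < ‖P.φ X‖ := norm_pos_iff.2 ((map_ne_zero_iff P.φ P.φ_injective).2 hX)
  exact pos_of_mul_pos_left (h.trans_le (norm_φ_le X)) (norm_nonneg X)

theorem norm_pair_le (X Y : P.F) : ‖P.pair X Y‖ ≤ P.Lphi * ‖X‖ * ‖Y‖ := by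
  refine (norm_mmul_le (mtr (P.φ X : Mat n p)) (Y : Mat n p)).trans ?_
  rw [norm_mtr]
  exact mul_le_mul_of_nonneg_right (norm_φ_le X) (norm_nonneg Y)

theorem norm_dC_le (X Z : P.F) : ‖P.dC X Z‖ ≤ 2 * P.Lphi * ‖X‖ * ‖Z‖ := by
  rw [dC_apply, norm_mtr]
  have h : ‖P.sym X Z‖ ≤ ‖P.pair X Z‖ + ‖P.pair Z X‖ := norm_add_le _ _
  exact h.trans (by linarith [norm_pair_le X Z, norm_pair_le Z X])

theorem sigmaMin_le (X : P.F) : P.sigmaMin X ≤ 2 * P.Lphi * ‖X‖ := by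
  have := Lphi_nonneg (P := P)
  refine singularValues_le _ (by positivity) (fun Z => ?_) _
  have h : fderiv ℝ P.C X = P.dC X := (P.hasFDerivAt_C X).fderiv
  rw [h]
  exact norm_dC_le X Z

/-- At a feasible point `DC(X)` maps onto `𝒮₁`, so its smallest singular value is positive. -/
theorem sigmaMin_pos {X : P.F} (hX : X ∈ P.M) (hp : p ≠ 0) : 0 < P.sigmaMin X := by
  have h : fderiv ℝ P.C X = P.dC X := (P.hasFDerivAt_C X).fderiv
  rw [sigmaMin, h, LinearMap.singularValues_pos_iff_lt_finrank_range]
  -- `DC(X)[X T] = Tᵀ + ψ(T)`.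
  have hle : P.S₁ ≤ LinearMap.range (P.dC X).toLinearMap := by
    rintro _ ⟨T, rfl⟩
    refine ⟨P.act X T, ?_⟩
    have h1 : toMatrix (P.pair X X : Mat p p) = 1 := congrArg toMatrix (coe_pair_self_of_mem hX)
    rw [coe_pair, toMatrix_mmul, toMatrix_mtr] at h1
    refine toMatrix_injective ?_
    change toMatrix (P.dC X (P.act X T)) = toMatrix (mtr (T : Mat p p) + (P.ψ T : Mat p p))
    rw [dC_apply, sym_apply, Submodule.coe_add, coe_pair, coe_pair, φ_act, coe_act, coe_act]
    simp [Matrix.mul_assoc, ← Matrix.mul_assoc _ _ (toMatrix (T : Mat p p)), h1]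
  have hpos : 0 < Module.finrank ℝ (LinearMap.range (P.dC X).toLinearMap) := by
    rw [Nat.pos_iff_ne_zero, ne_eq, Submodule.finrank_eq_zero, LinearMap.range_eq_bot]
    intro h0
    have h1 : P.dC X X = 0 := LinearMap.congr_fun h0 X
    rw [dC_eq_zero_iff, sym_apply, ← two_smul ℝ, smul_eq_zero_iff_right two_ne_zero] at h1
    exact mone_ne_zero hp ((coe_pair_self_of_mem hX).symm.trans (congrArg Subtype.val h1))
  have := Submodule.finrank_mono hle
  omega

/-- The constraint violation near a feasible point. -/
theorem norm_C_le {X : P.F} (hX : X ∈ P.M) (Y : P.F) :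
    ‖P.C Y‖ ≤ P.Lphi * (‖X‖ + ‖Y‖) * ‖Y - X‖ := by
  have h : P.C Y = mtr ((P.pair Y (Y - X) + P.pair (Y - X) X : gram P.F) : Mat p p) := by
    have e1 : mtr (mone p) = mone p := toMatrix_injective (by simp)
    have e2 : P.pair Y (Y - X) + P.pair (Y - X) X = P.pair Y Y - P.pair X X := by
      rw [map_sub, map_sub, sub_apply]; abel
    rw [e2, AddSubgroupClass.coe_sub, coe_pair_self_of_mem hX, map_sub, e1, C_eq]
  rw [h, norm_mtr]
  have h1 := norm_add_le (P.pair Y (Y - X)) (P.pair (Y - X) X)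
  exact h1.trans (by linarith [norm_pair_le Y (Y - X), norm_pair_le (Y - X) X])

theorem norm_gradient_le_Mf {f : P.F → ℝ} (hf' : Differentiable ℝ (∇ f)) {X Y : P.F}
    (hY : Y ∈ P.Delta X) : ‖∇ f (P.A Y)‖ ≤ P.Mf f X := by
  refine le_csSup ?_ ⟨Y, hY, rfl⟩
  have hc : Continuous fun Y => ‖∇ f (P.A Y)‖ := (hf'.continuous.comp
    (continuous_iff_continuousAt.2 fun x => (P.hasFDerivAt_A x).continuousAt)).norm
  obtain ⟨K, hK⟩ := (isCompact_closedBall X (P.rho X)).bddAbove_image hc.continuousOn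
  refine ⟨K, ?_⟩
  rintro r ⟨Y, hY, rfl⟩
  exact hK ⟨Y, mem_closedBall_iff_norm.2 hY, rfl⟩

/-! ### Equivalence of the stationarity conditions -/

variable {f : P.F → ℝ} {β : ℝ}

/-- A stationary point of `h` with `‖C(Y)‖ ≤ 1 / 2` is feasible once `β` exceeds
`(3 / 2) ‖∇f(𝒜(Y))‖ ‖Y‖`: pairing `∇h(Y) = 0` with `Y C(Y)ᵀ` leaves at least `β ‖C(Y)‖²`
against at most `(3 / 2) ‖∇f(𝒜(Y))‖ ‖Y‖ ‖C(Y)‖²`. -/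
theorem mem_M_of_gradient_cdf_eq_zero (hf : Differentiable ℝ f) {Y : P.F} {m : ℝ}
    (hC : ‖P.C Y‖ ≤ 1 / 2) (hm : ‖∇ f (P.A Y)‖ * ‖Y‖ ≤ m) (hβ : 3 / 2 * m < β)
    (h : ∇ (P.cdf f β) Y = 0) : Y ∈ P.M := by
  obtain ⟨V, hV, e⟩ := inner_gradient_cdf_test hf β Y
  rw [h, inner_zero_left] at e
  have hm0 : 0 ≤ m := le_trans (by positivity) hm
  have h1 : ⟪∇ f (P.A Y), V⟫_ℝ ≤ m * ‖P.C Y‖ ^ 2 := by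
    refine (real_inner_le_norm _ _).trans ((mul_le_mul_of_nonneg_left hV (norm_nonneg _)).trans ?_)
    rw [← mul_assoc]
    exact mul_le_mul_of_nonneg_right hm (by positivity)
  have h2 : -(1 / 2 * ‖P.C Y‖ ^ 2) ≤ ⟪P.C Y, mmul (P.C Y) (P.C Y)⟫_ℝ := by
    have h3 := (abs_le.1 (abs_real_inner_le_norm (P.C Y) (mmul (P.C Y) (P.C Y)))).1
    have h4 : ‖P.C Y‖ * ‖mmul (P.C Y) (P.C Y)‖ ≤ 1 / 2 * (‖P.C Y‖ * ‖P.C Y‖) :=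
      mul_le_mul hC (norm_mmul_le _ _) (norm_nonneg _) (by norm_num)
    nlinarith
  have h5 : (β - 3 / 2 * m) * ‖P.C Y‖ ^ 2 ≤ 0 := by nlinarith
  have h6 : ‖P.C Y‖ ^ 2 ≤ 0 := by
    by_contra! h
    exact absurd h5 (not_le.2 (mul_pos (sub_pos.2 hβ) h))
  rw [mem_M_iff_C_eq_zero, ← norm_eq_zero]
  exact pow_eq_zero_iff (two_ne_zero) |>.1 (le_antisymm h6 (by positivity))

/-- At a feasible point both notions agree once `β ≥ (3 / 4) ‖∇f(Y)‖ ‖Y‖`: the penalty then makes up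
for the negative curvature that `f ∘ 𝒜` can have off the tangent space. -/
theorem isSecondOrderStationary_iff_of_mem (hf : Differentiable ℝ f)
    (hf' : Differentiable ℝ (∇ f)) {Y : P.F} (hY : Y ∈ P.M) {m : ℝ}
    (hm : ‖∇ f Y‖ * ‖Y‖ ≤ m) (hβ : 3 / 4 * m ≤ β) :
    P.IsSecondOrderStationaryCDF f β Y ↔ P.IsSecondOrderStationary f Y := by
  rw [IsSecondOrderStationaryCDF, IsSecondOrderStationary, gradient_cdf_eq_zero_iff_of_mem hf β hY,
    and_iff_right hY]
  refine and_congr_right fun hg => ?_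
  have hT : ∀ Z ∈ P.tangentSpace Y, ⟪Z, P.rhess f Y Z⟫_ℝ =
      ⟪Z, fderiv ℝ (∇ f) Y Z⟫_ℝ + ⟪∇ f Y, P.d2A Y Z⟫_ℝ := fun Z hZ => by
    rw [inner_rhess hf hf' hY hg hZ, inner_hessian_cdf_of_mem hf hf' 0 hY,
      dA_eq_self_of_sym_eq_zero hY ((mem_tangentSpace_iff hY).1 hZ), zero_mul, add_zero]
  constructor
  · intro h Z hZ
    have hZ' := (mem_tangentSpace_iff hY).1 hZ
    have h1 := h Z
    rw [inner_hessian_cdf_of_mem hf hf' β hY, dA_eq_self_of_sym_eq_zero hY hZ', hZ', norm_zero] at h1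
    rw [hT Z hZ]
    linarith
  · intro h Z
    have h1 := h _ ((mem_tangentSpace_iff hY).2 (sym_dA_of_mem hY Z))
    rw [hT _ ((mem_tangentSpace_iff hY).2 (sym_dA_of_mem hY Z))] at h1
    rw [inner_hessian_cdf_of_mem hf hf' β hY]
    have h2 := inner_d2A_sub hY hg Z
    have h3 : ⟪∇ f Y, P.act (P.act Y (P.sym Y Z)) (P.sym Y Z)⟫_ℝ ≤ m * ‖P.sym Y Z‖ ^ 2 := by
      refine (real_inner_le_norm _ _).trans ?_
      have h4 : ‖P.act (P.act Y (P.sym Y Z)) (P.sym Y Z)‖ ≤ ‖Y‖ * ‖P.sym Y Z‖ ^ 2 := by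
        refine (norm_act_le P _ _).trans ?_
        rw [pow_two, ← mul_assoc]
        exact mul_le_mul_of_nonneg_right (norm_act_le P _ _) (norm_nonneg _)
      refine (mul_le_mul_of_nonneg_left h4 (norm_nonneg _)).trans ?_
      rw [← mul_assoc]
      exact mul_le_mul_of_nonneg_right hm (by positivity)
    have h5 : 3 / 4 * m * ‖P.sym Y Z‖ ^ 2 ≤ β * ‖P.sym Y Z‖ ^ 2 :=
      mul_le_mul_of_nonneg_right hβ (by positivity)
    linarith

/-- As `σ ≤ 2 a L / 3`, the first entry of the maximum defining the threshold dominates `a M / 2`,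
which bounds `(3 / 2) ‖∇f(𝒜(Y))‖ ‖Y‖` since `‖Y‖ ≤ a / 3`. -/
theorem half_mul_le_threshold {a L M σ : ℝ} (ha : 0 ≤ a) (hL : 0 ≤ L) (hM : 0 ≤ M) (hσ : 0 < σ)
    (h : σ ≤ 2 / 3 * (a * L)) :
    1 / 2 * (a * M) ≤ (2 * a ^ 3 * L ^ 2 * M + 30 * a * L * M) / (3 * σ ^ 2) := by
  rw [le_div_iff₀ (by positivity)]
  have h1 : σ ^ 2 ≤ (2 / 3 * (a * L)) ^ 2 := pow_le_pow_left₀ hσ.le h 2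
  have h2 : 0 ≤ a * M := by positivity
  have h3 := mul_le_mul_of_nonneg_left h1 h2
  have h4 : 0 ≤ a * L * M := by positivity
  have h5 : 0 ≤ a ^ 3 * L ^ 2 * M := by positivity
  nlinarith

/-- Within the third entry of the radius `ε` the bound of `norm_C_le` is at most `1 / 2`; the
number `2 a / 3` bounds `‖X‖ + ‖Y‖`. -/
theorem violation_le {a L σ d : ℝ} (ha : 0 ≤ a) (hL : 0 < L) (hσ : σ ≤ 2 / 3 * (a * L))
    (hd : d ≤ σ / (2 * a ^ 2 * L ^ 2 + 6 * L)) : L * (2 / 3 * a) * d ≤ 1 / 2 := by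
  have hpos : 0 < 2 * a ^ 2 * L ^ 2 + 6 * L := by positivity
  rw [le_div_iff₀ hpos] at hd
  have h1 := mul_le_mul_of_nonneg_left (hd.trans hσ) (show 0 ≤ L * (2 / 3 * a) by positivity)
  have h2 : L * (2 / 3 * a) * d * (2 * a ^ 2 * L ^ 2 + 6 * L)
      ≤ 1 / 2 * (2 * a ^ 2 * L ^ 2 + 6 * L) := by
    have : 0 ≤ a ^ 2 * L ^ 2 := by positivity
    nlinarith
  exact le_of_mul_le_mul_right h2 hpos

end Constraint

end GOOCP

end

theorem mainTheorem1 {n p : ℕ} (P : GOOCP.Constraint n p)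
    (f : P.F → ℝ) (hf : Differentiable ℝ f) (hf' : Differentiable ℝ (gradient f))
    (X : P.F) (hX : X ∈ P.M)
    (αA αCA : ℝ) (hαA : P.IsAlphaA X αA) (hαCA : P.IsAlphaCA X αCA)
    (β : ℝ) (hβ : P.betaThreshold f X αA αCA < β) :
    ∀ Y ∈ P.Omega X αA αCA,
      P.IsSecondOrderStationaryCDF f β Y ↔ P.IsSecondOrderStationary f Y := by
  open GOOCP GOOCP.Constraint in
  intro Y hY
  rcases eq_or_ne p 0 with hp | hp
  · -- For `p = 0` the space `ℱ` is trivial, and every condition holds.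
    subst hp
    have : Subsingleton P.F :=
      ⟨fun Z W => Subtype.ext (toMatrix_injective (Subsingleton.elim _ _))⟩
    refine iff_of_true ⟨Subsingleton.elim _ _, fun T => ?_⟩
      ⟨Subsingleton.elim X Y ▸ hX, Subsingleton.elim _ _, fun T _ => ?_⟩ <;>
    rw [Subsingleton.elim T 0, inner_zero_left]
  have hX0 : X ≠ 0 := by
    rintro rfl
    have h0 := coe_pair_self_of_mem hX
    rw [map_zero] at h0
    exact mone_ne_zero hp h0.symm
  have hε : ‖Y - X‖ ≤ P.eps X αA αCA := hY
  rw [eps, le_min_iff, le_min_iff, le_min_iff] at hε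
  obtain ⟨hε1, -, hε3, -⟩ := hε
  have hρ : 0 ≤ P.rho X := by linarith [norm_nonneg (Y - X)]
  have hXΔ : X ∈ P.Delta X := by simpa [Delta] using hρ
  have hYΔ : Y ∈ P.Delta X := hε1.trans (by linarith)
  have hXa := hαA.norm_le X hXΔ
  have hYa := hαA.norm_le Y hYΔ
  have hXpos : 0 < ‖X‖ := norm_pos_iff.2 hX0
  have ha : 0 < αA := by linarith
  have hL : 0 < P.Lphi := Lphi_pos hX0
  have hσ : P.sigmaMin X ≤ 2 / 3 * (αA * P.Lphi) :=
    (sigmaMin_le X).trans (by nlinarith)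
  have hg := norm_gradient_le_Mf hf' hYΔ
  have hM0 : 0 ≤ P.Mf f X := (norm_nonneg _).trans hg
  have hm : ‖gradient f (P.A Y)‖ * ‖Y‖ ≤ 1 / 3 * (αA * P.Mf f X) :=
    (mul_le_mul hg hYa (norm_nonneg _) hM0).trans (by linarith)
  have hβ1 : 1 / 2 * (αA * P.Mf f X) < β :=
    (half_mul_le_threshold ha.le hL.le hM0 (sigmaMin_pos hX hp) hσ).trans_lt
      ((le_max_left _ _).trans_lt hβ)
  have hpos : 0 ≤ αA * P.Mf f X := by positivity
  have hC : ‖P.C Y‖ ≤ 1 / 2 := by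
    refine (norm_C_le hX Y).trans (le_trans ?_ (violation_le ha.le hL hσ hε3))
    refine mul_le_mul_of_nonneg_right (mul_le_mul_of_nonneg_left ?_ hL.le) (norm_nonneg _)
    linarith
  have key : Y ∈ P.M → (P.IsSecondOrderStationaryCDF f β Y ↔ P.IsSecondOrderStationary f Y) :=
    fun hYM => isSecondOrderStationary_iff_of_mem hf hf' hYM (A_of_mem hYM ▸ hm) (by linarith)
  exact ⟨fun h => (key (mem_M_of_gradient_cdf_eq_zero hf hC hm (by linarith) h.1)).1 h,
    fun h => (key h.1).2 h⟩
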